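/- **Notation.** For $r\in\mathbb R$ let $S^r$ be the set of $\sigma\in C^\infty(\mathbb R^3\times\mathbb R^3;\mathbb C)$ such that for all multi-indices $\alpha,\beta$ there is a constant $C_{\alpha,\beta}$ with $|\partial_x^\alpha\partial_\xi^\beta\sigma(x,\xi)|\le C_{\alpha,\beta}(1+|\xi|)^{r-|\beta|}$ for all $x,\xi$. For $\sigma\in S^r$ and $\varphi\in\mathscr S(\mathbb R^3)$ put $(T_\sigma\varphi)(x)=(2\pi)^{-3}\int e^{ix\cdot\xi}\sigma(x,\xi)\int e^{-iy\cdot\xi}\varphi(y)\,dy\,d\xi$. Let $(\Omega,\mathbb P)$ be a probability space, $D_f\subset\mathbb R^3$ bounded and $m\in\mathbb R$. A *microlocally isotropic Gaussian random field of rough order $-m$ and rough strength $\mu$ in $D_f$* is a random tempered distribution $f(\cdot,\omega)\in\mathscr S'(\mathbb R^3)$ such that 1. $\langle f,\varphi\rangle$ is a (complex, possibly degenerate) Gaussian random variable for every $\varphi\in\mathscr S(\mathbb R^3)$; 2. $\mathbb E f\in C_c^\infty(\mathbb R^3)$ and $\operatorname{supp}\mathbb E f\subset D_f$, where $\langle\mathbb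 Ef,\varphi\rangle=\mathbb E\langle f,\varphi\rangle$; 3. $\operatorname{supp}f\subset D_f$ almost surely; 4. the covariance operator $\mathfrak C_f$, given by $(\mathfrak C_f\varphi)(\psi)=\mathbb E\big(\langle\overline{f-\mathbb Ef},\varphi\rangle\,\langle f-\mathbb Ef,\psi\rangle\big)$ for $\varphi,\psi\in\mathscr S(\mathbb R^3)$, is the pseudodifferential operator $T_c$ of some symbol $c\in S^{-m}$, that is, $(\mathfrak C_f\varphi)(\psi)=\int (T_c\varphi)(x)\,\psi(x)\,dx$; 5. $c$ has principal symbol $\mu(x)|\xi|^{-m}$, that is, $c(x,\xi)-(1-\chi(\xi))\mu(x)|\xi|^{-m}\in S^{-m-1}$ for a cutoff $\chi\in C_c^\infty(\mathbb R^3)$ with $\chi=1$ near $0$, where $\mu\in C_c^\infty(\mathbb R^3;\mathbb R)$, $\mu\ge0$ and $\operatorname{supp}\mu\subset D_f$. For $k>0$ let $(\mathcal R_k\varphi)(x)=\int_{\mathbb R^3}\frac{e^{ik|x-y|}}{4\pi|x-y|}\varphi(y)\,dy$ for $\varphi\in C_c^\infty(\mathbb R^3)$; this is a smooth function. For a compactly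 supported distribution $g$, the distribution $\mathcal R_kg$ is given by $\langle\mathcal R_kg,\varphi\rangle=\langle g,\mathcal R_k\varphi\rangle$ for $\varphi\in C_c^\infty(\mathbb R^3)$, where the pairing of $g$ with a smooth function $v$ is $\langle g,\chi v\rangle$ for any $\chi\in C_c^\infty(\mathbb R^3)$ equal to $1$ near $\operatorname{supp}g$. For $\delta\in\mathbb R$ let $L^2_\delta(\mathbb R^3)$ be the space of $u\in L^1_{\rm loc}(\mathbb R^3)$ with $\int(1+|x|^2)^{\delta}|u(x)|^2\,dx<\infty$. **Lemma 2.2.** Let $m>2$, let $D_f\subset\mathbb R^3$ be bounded, and let $f$ be a microlocally isotropic Gaussian random field of rough order $-m$ in $D_f$. Then for every $k>0$, almost surely, $\mathcal R_kf\in L^2_{-1/2-\epsilon}(\mathbb R^3)$ for every $\epsilon>0$; that is, the distribution $\mathcal R_kf$ is given by a function in $L^2_{-1/2-\epsilon}(\mathbb R^3)$. -/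

import Mathlib

open MeasureTheory ProbabilityTheory Filter Topology
open scoped SchwartzMap

namespace RandomScattering

noncomputable section

open scoped ContDiff ComplexConjugate

/-- `ℝⁿ` with its Euclidean norm. -/
abbrev RSpace (n : ℕ) : Type := EuclideanSpace ℝ (Fin n)

/-! ### Symbols and pseudodifferential operators -/

/-- The Kohn–Nirenberg symbol class `S^r`: smooth `σ(x, ξ)` all of whose mixed derivatives, of order
`a` in `x` and `b` in `ξ`, are bounded by `C_{a,b} (1 + |ξ|)^{r - b}`.  The derivatives of given
orders are collected in the iterated Fréchet derivative, whose norm controls, and is controlled by,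
the partial derivatives `∂_x^α ∂_ξ^β σ` with `|α| = a`, `|β| = b`. -/
def IsSymbol {n : ℕ} (r : ℝ) (σ : RSpace n → RSpace n → ℂ) : Prop :=
  ContDiff ℝ ∞ (fun p : RSpace n × RSpace n => σ p.1 p.2) ∧
  ∀ a b : ℕ, ∃ C : ℝ, ∀ x ξ : RSpace n,
    ‖iteratedFDeriv ℝ a (fun x' => iteratedFDeriv ℝ b (σ x') ξ) x‖
      ≤ C * (1 + ‖ξ‖) ^ (r - (b : ℝ))

/-- The symbol `c ∈ S^{-m}` has principal symbol `μ(x) |ξ|^{-m}`: the difference is in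
`S^{-m-1}`.  As `|ξ|^{-m}` is not smooth at `ξ = 0`, it is multiplied by `1 - χ(ξ)` where `χ` is
a cutoff function equal to `1` near `0`; the choice of `χ` does not matter. -/
def HasPrincipalSymbol {n : ℕ} (c : RSpace n → RSpace n → ℂ) (m : ℝ) (μ : RSpace n → ℝ) : Prop :=
  ∃ χ : RSpace n → ℝ, ContDiff ℝ ∞ χ ∧ HasCompactSupport χ ∧ (∀ᶠ ξ in 𝓝 0, χ ξ = 1) ∧
    IsSymbol (-m - 1) (fun x ξ => c x ξ - (((1 - χ ξ) * (μ x * ‖ξ‖ ^ (-m)) : ℝ) : ℂ))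

/-- The pseudodifferential operator with symbol `σ`,
`(T_σ φ)(x) = (2π)^{-n} ∫ e^{i x·ξ} σ(x, ξ) (∫ e^{-i y·ξ} φ(y) dy) dξ`. -/
def pseudoDiff {n : ℕ} (σ : RSpace n → RSpace n → ℂ) (φ : 𝓢(RSpace n, ℂ)) (x : RSpace n) : ℂ :=
  (((2 * Real.pi) ^ n : ℝ) : ℂ)⁻¹ *
    ∫ ξ : RSpace n, Complex.exp (Complex.I * (inner ℝ x ξ : ℝ)) * σ x ξ *
      ∫ y : RSpace n, Complex.exp (-(Complex.I * (inner ℝ y ξ : ℝ))) * φ y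

/-! ### Microlocally isotropic Gaussian random fields -/

/-- The complex conjugate of a Schwartz function. -/
def conjSchwartz {n : ℕ} (φ : 𝓢(RSpace n, ℂ)) : 𝓢(RSpace n, ℂ) :=
  SchwartzMap.postcompCLM (𝕜 := ℝ) (Complex.conjCLE : ℂ →L[ℝ] ℂ) φ

/-- The covariance of a random distribution,
`(𝔠_f φ)(ψ) = 𝔼(⟨conj(f - 𝔼f), φ⟩ ⟨f - 𝔼f, ψ⟩)`, where the conjugate of a distribution `u` is
given by `⟨conj u, φ⟩ = conj ⟨u, conj φ⟩`, so that `𝔠_f` is bilinear in `(φ, ψ)`. -/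
def covariancePairing {n : ℕ} {Ω : Type*} [MeasurableSpace Ω] (P : Measure Ω)
    (f : Ω → 𝓢'(RSpace n, ℂ)) (φ ψ : 𝓢(RSpace n, ℂ)) : ℂ :=
  ∫ w, conj (f w (conjSchwartz φ) - ∫ w', f w' (conjSchwartz φ) ∂P) *
    (f w ψ - ∫ w', f w' ψ ∂P) ∂P

/-- `f` is a microlocally isotropic generalized Gaussian random field (migr field) on `ℝⁿ` with
rough order `-m` and rough strength `μ` in the set `D`.  As `f w` is linear, Gaussianity of each
single complex random variable `⟨f, φ⟩` gives joint Gaussianity of finitely many of them.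
The covariance operator is a pseudodifferential operator with a symbol in `S^{-m}` and principal
symbol `μ(x) |ξ|^{-m}`; no homogeneous expansion of the lower order terms is required, so fields
whose covariance symbol is polyhomogeneous are included. -/
structure IsMigrField {n : ℕ} {Ω : Type*} [MeasurableSpace Ω] (P : Measure Ω)
    (f : Ω → 𝓢'(RSpace n, ℂ)) (m : ℝ) (μ : RSpace n → ℝ) (D : Set (RSpace n)) : Prop where
  gaussian : ∀ φ : 𝓢(RSpace n, ℂ), HasGaussianLaw (fun w => f w φ) P
  expectation : ∃ g : RSpace n → ℂ, ContDiff ℝ ∞ g ∧ HasCompactSupport g ∧ tsupport g ⊆ D ∧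
    ∀ φ : 𝓢(RSpace n, ℂ), ∫ w, f w φ ∂P = ∫ x, g x * φ x
  support_subset : ∀ᵐ w ∂P, Distribution.dsupport (f w) ⊆ D
  strength_contDiff : ContDiff ℝ ∞ μ
  strength_hasCompactSupport : HasCompactSupport μ
  strength_tsupport_subset : tsupport μ ⊆ D
  strength_nonneg : ∀ x, 0 ≤ μ x
  covariance : ∃ c : RSpace n → RSpace n → ℂ, IsSymbol (-m) c ∧ HasPrincipalSymbol c m μ ∧
    ∀ φ ψ : 𝓢(RSpace n, ℂ), covariancePairing P f φ ψ = ∫ x, pseudoDiff c φ x * ψ x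

/-! ### Weighted `L²` spaces -/

/-- `u ∈ L²_δ(ℝⁿ)`: `u` is locally integrable and `(1 + |x|²)^{δ/2} u` is square integrable. -/
def MemWeightedL2 {n : ℕ} (δ : ℝ) (u : RSpace n → ℂ) : Prop :=
  LocallyIntegrable u volume ∧
    MemLp (fun x => (((1 + ‖x‖ ^ 2) ^ (δ / 2) : ℝ) : ℂ) * u x) 2 volume

/-! ### The resolvent in three dimensions -/

/-- The outgoing fundamental solution `Φ_k(x, y) = e^{ik|x-y|} / (4π|x-y|)` of `-Δ - k²`. -/
def outgoingKernel (k : ℝ) (x y : RSpace 3) : ℂ :=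
  Complex.exp (Complex.I * k * ‖x - y‖) / (4 * Real.pi * ‖x - y‖)

/-- The resolvent `(R_k φ)(x) = ∫ Φ_k(x, y) φ(y) dy` on functions. -/
def resolvent (k : ℝ) (φ : RSpace 3 → ℂ) (x : RSpace 3) : ℂ :=
  ∫ y, outgoingKernel k x y * φ y

theorem locallyIntegrable_outgoingKernel (k : ℝ) :
    LocallyIntegrable (fun x => outgoingKernel k x 0) (volume : Measure (RSpace 3)) := by
  have hmeas : Measurable (fun x => outgoingKernel k x 0) := by
    unfold outgoingKernel
    fun_prop
  have hloc : LocallyIntegrable (fun x : RSpace 3 => ‖x‖⁻¹) volume := by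
    rw [locallyIntegrable_iff]
    intro K hK
    obtain ⟨r, hr⟩ := hK.isBounded.subset_ball 0
    refine IntegrableOn.mono_set ?_ hr
    rw [integrableOn_fun_norm_addHaar (μ := volume) (f := fun t : ℝ => t⁻¹)]
    have hid : IntegrableOn (fun t : ℝ => t) (Set.Ioo 0 r) volume :=
      (continuous_id.integrableOn_Icc (a := 0) (b := r)).mono_set Set.Ioo_subset_Icc_self
    refine hid.congr_fun (fun t ht => ?_) measurableSet_Ioo
    have : t ≠ 0 := ht.1.ne'
    simp only [finrank_euclideanSpace, Fintype.card_fin, smul_eq_mul]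
    field_simp
  refine hloc.mono hmeas.aestronglyMeasurable (Eventually.of_forall fun x => ?_)
  have h : ‖Complex.exp (Complex.I * k * ‖x‖)‖ = 1 := by
    rw [Complex.norm_exp]
    simp
  simp only [outgoingKernel, sub_zero, norm_div, h, norm_mul, Complex.norm_real, norm_norm,
    Complex.norm_ofNat, norm_inv, Real.norm_of_nonneg Real.pi_pos.le, one_div, mul_inv]
  have h4 : (4 : ℝ)⁻¹ * Real.pi⁻¹ ≤ 1 := by
    rw [← mul_inv]
    exact inv_le_one_of_one_le₀ (by nlinarith [Real.pi_gt_three])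
  exact mul_le_of_le_one_left (by positivity) h4

theorem contDiff_resolvent (k : ℝ) {φ : RSpace 3 → ℂ} (h₁ : ContDiff ℝ ∞ φ)
    (h₂ : HasCompactSupport φ) : ContDiff ℝ ∞ (resolvent k φ) := by
  have h := h₂.contDiff_convolution_left (ContinuousLinearMap.mul ℝ ℂ) h₁
    (locallyIntegrable_outgoingKernel k)
  convert h using 1
  ext x
  simp only [resolvent, convolution, ContinuousLinearMap.mul_apply']
  refine integral_congr_ae (Eventually.of_forall fun y => ?_)
  simp [outgoingKernel, mul_comm]

/-- A smooth compactly supported function on `ℝ³`. -/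
structure TestFn where
  toFun : RSpace 3 → ℂ
  smooth : ContDiff ℝ ∞ toFun
  compactSupport : HasCompactSupport toFun

/-- The test function `χ · R_k φ`, which is smooth with compact support. -/
def cutoffResolvent (k : ℝ) (χ φ : TestFn) : 𝓢(RSpace 3, ℂ) :=
  HasCompactSupport.toSchwartzMap (f := fun x => χ.toFun x * resolvent k φ.toFun x)
    χ.compactSupport.mul_right
    (χ.smooth.mul (contDiff_resolvent k φ.smooth φ.compactSupport))

/-- For a compactly supported distribution `f`, the distribution `R_k f = Φ_k * f` is given by the
function `u`.  Since `Φ_k(x, y) = Φ_k(y, x)`, the distribution `R_k f` is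
`⟨R_k f, φ⟩ = ⟨f, R_k φ⟩` for `φ ∈ C_c^∞`.  Here `R_k φ` is smooth, and the pairing with the
compactly supported `f` is `⟨f, χ R_k φ⟩`, for any cutoff function `χ` that is `1` near
the support of `f`. -/
def IsResolventOf (k : ℝ) (f : 𝓢'(RSpace 3, ℂ)) (u : RSpace 3 → ℂ) : Prop :=
  IsCompact (Distribution.dsupport f) ∧ LocallyIntegrable u volume ∧
  ∀ χ φ : TestFn, (∀ᶠ x in 𝓝ˢ (Distribution.dsupport f), χ.toFun x = 1) →
    f (cutoffResolvent k χ φ) = ∫ x, u x * φ.toFun x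

/-- `R_k f ∈ L²_δ(ℝ³)` for a compactly supported distribution `f`. -/
def ResolventMemWeightedL2 (k : ℝ) (f : 𝓢'(RSpace 3, ℂ)) (δ : ℝ) : Prop :=
  ∃ u : RSpace 3 → ℂ, IsResolventOf k f u ∧ MemWeightedL2 δ u

end

end RandomScattering

/-!
Since `c ∈ S^{-m}` with `m > 3/2`, `T_c` maps `L²` to bounded functions, so `𝔼|⟨f, ψ⟩|² ≤ C ‖ψ‖²`
for `ψ` supported in a fixed compact set. The kernel `Φ_k(·, 0)` lies in `L²_δ` for `δ < -1/2`,
which makes `χ R_k : L²_{-δ} → L²` a Hilbert–Schmidt operator for every cutoff function `χ`. Hence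
`∑ᵢ 𝔼|⟨f, χ R_k vᵢ⟩|² < ∞` for test functions `vᵢ` that are orthonormal in `L²_{-δ}`, and almost
surely the Riesz–Fischer theorem gives `u ∈ L²_δ` with `⟨R_k f, vᵢ⟩ = ∫ u vᵢ`. As `C_c^∞` is
separable, countably many `vᵢ` whose span is dense in `C_c^∞` suffice, so that one null set serves
all test functions.
-/

namespace RandomScattering

open TopologicalSpace Distributions
open scoped ContDiff ComplexConjugate ENNReal NNReal BoundedContinuousFunction Convolution Pointwise

noncomputable section

/-! ### Second moments of random distributions -/

section HolderEstimates

variable {α 𝕜 : Type*} [MeasurableSpace α] [RCLike 𝕜] {ν : Measure α}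

theorem enorm_integral_mul_le_eLpNorm_two_mul {u v : α → 𝕜} (hu : AEStronglyMeasurable u ν)
    (hv : AEStronglyMeasurable v ν) :
    ‖∫ x, u x * v x ∂ν‖ₑ ≤ eLpNorm u 2 ν * eLpNorm v 2 ν :=
  calc ‖∫ x, u x * v x ∂ν‖ₑ ≤ eLpNorm (u • v) 1 ν := by
        rw [eLpNorm_one_eq_lintegral_enorm]
        exact enorm_integral_le_lintegral_enorm _
    _ ≤ eLpNorm u 2 ν * eLpNorm v 2 ν := eLpNorm_smul_le_mul_eLpNorm hv hu

theorem enorm_integral_mul_le_of_eq_zero {u v : α → 𝕜} (hv : AEStronglyMeasurable v ν)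
    {K : Set α} (hvK : ∀ x ∉ K, v x = 0) {C : ℝ≥0∞} (hu : ∀ x, ‖u x‖ₑ ≤ C) :
    ‖∫ x, u x * v x ∂ν‖ₑ ≤ C * (eLpNorm v 2 ν * ν K ^ (1 / 2 : ℝ)) :=
  calc ‖∫ x, u x * v x ∂ν‖ₑ = ‖∫ x in K, u x * v x ∂ν‖ₑ := by
        rw [setIntegral_eq_integral_of_forall_compl_eq_zero fun x hx => by rw [hvK x hx, mul_zero]]
    _ ≤ ∫⁻ x in K, C * ‖v x‖ₑ ∂ν := by
        refine (enorm_integral_le_lintegral_enorm _).trans (lintegral_mono fun x => ?_)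
        rw [enorm_mul]
        gcongr
        exact hu x
    _ = C * eLpNorm v 1 (ν.restrict K) := by
        rw [lintegral_const_mul'' _ hv.restrict.enorm, eLpNorm_one_eq_lintegral_enorm]
    _ ≤ C * (eLpNorm v 2 ν * ν K ^ (1 / 2 : ℝ)) := by
        gcongr
        refine (eLpNorm_le_eLpNorm_mul_rpow_measure_univ one_le_two hv.restrict).trans ?_
        have hexp : 1 / (1 : ℝ≥0∞).toReal - 1 / (2 : ℝ≥0∞).toReal = 1 / 2 := by norm_num
        rw [hexp, Measure.restrict_apply_univ]
        gcongr
        exact Measure.restrict_le_self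

theorem eLpNorm_two_sq {E : Type*} [NormedAddCommGroup E] (u : α → E) :
    eLpNorm u 2 ν ^ 2 = ∫⁻ x, ‖u x‖ₑ ^ 2 ∂ν := by
  simpa using eLpNorm_nnreal_pow_eq_lintegral (μ := ν) (f := u) (p := 2) two_ne_zero

theorem enorm_integral_conj_mul_self {u : α → ℂ} (hu : MemLp u 2 ν) :
    ‖∫ x, conj (u x) * u x ∂ν‖ₑ = eLpNorm u 2 ν ^ 2 := by
  have hsq : ∀ x, conj (u x) * u x = ((‖u x‖ ^ 2 : ℝ) : ℂ) := fun x => by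
    rw [Complex.conj_mul', Complex.ofReal_pow]
  simp only [hsq]
  rw [integral_complex_ofReal, ← ofReal_norm, Complex.norm_real,
    Real.norm_of_nonneg (integral_nonneg fun _ => by positivity), eLpNorm_two_sq,
    ofReal_integral_eq_lintegral_ofReal (hu.integrable_norm_pow two_ne_zero)
      (Eventually.of_forall fun _ => by positivity)]
  simp only [ENNReal.ofReal_pow (norm_nonneg _), ofReal_norm]

end HolderEstimates

theorem eLpNorm_comp_smul {E F : Type*} [NormedAddCommGroup E] [NormedSpace ℝ E]
    [FiniteDimensional ℝ E] [MeasurableSpace E] [BorelSpace E] [NormedAddCommGroup F]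
    (ν : Measure E) [ν.IsAddHaarMeasure] {p : ℝ≥0∞} (hp : p ≠ ⊤) {a : ℝ} (ha : a ≠ 0) (u : E → F) :
    eLpNorm (fun x => u (a • x)) p ν =
      ENNReal.ofReal |(a ^ Module.finrank ℝ E)⁻¹| ^ (1 / p).toReal * eLpNorm u p ν := by
  rw [← smul_eq_mul, ← eLpNorm_smul_measure_of_ne_top hp, ← Measure.map_addHaar_smul ν ha,
    (measurableEmbedding_const_smul₀ ha).eLpNorm_map_measure]
  rfl

theorem memLp_two_one_add_norm_rpow {E : Type*} [NormedAddCommGroup E] [NormedSpace ℝ E]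
    [FiniteDimensional ℝ E] [MeasurableSpace E] [BorelSpace E] (ν : Measure E)
    [ν.IsAddHaarMeasure] {m : ℝ} (hm : Module.finrank ℝ E < 2 * m) :
    MemLp (fun ξ : E => (1 + ‖ξ‖) ^ (-m)) 2 ν := by
  have hmeas : Measurable fun ξ : E => (1 + ‖ξ‖) ^ (-m) := by fun_prop
  rw [memLp_two_iff_integrable_sq hmeas.aestronglyMeasurable]
  refine (integrable_one_add_norm hm).congr (Eventually.of_forall fun ξ => ?_)
  simp only [← Real.rpow_mul_natCast (add_nonneg zero_le_one (norm_nonneg ξ))]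
  congr 1
  push_cast
  ring

section PseudoDiff

variable {n : ℕ}

theorem IsSymbol.exists_norm_le {r : ℝ} {σ : RSpace n → RSpace n → ℂ} (h : IsSymbol r σ) :
    ∃ C : ℝ, ∀ x ξ, ‖σ x ξ‖ ≤ C * (1 + ‖ξ‖) ^ r := by
  simpa only [norm_iteratedFDeriv_zero, Nat.cast_zero, sub_zero] using h.2 0 0

theorem IsSymbol.continuous_right {r : ℝ} {σ : RSpace n → RSpace n → ℂ} (h : IsSymbol r σ)
    (x : RSpace n) : Continuous (σ x) :=
  h.1.continuous.comp (Continuous.prodMk_right x)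

theorem IsSymbol.exists_eLpNorm_two_le {m : ℝ} (hm : n < 2 * m) {c : RSpace n → RSpace n → ℂ}
    (hc : IsSymbol (-m) c) : ∃ C : ℝ≥0, ∀ x, eLpNorm (c x) 2 volume ≤ C := by
  obtain ⟨C, hC⟩ := hc.exists_norm_le
  have hL : MemLp (fun ξ : RSpace n => C * (1 + ‖ξ‖) ^ (-m)) 2 volume :=
    (memLp_two_one_add_norm_rpow volume (by simpa using hm)).const_mul C
  refine ⟨(eLpNorm (fun ξ : RSpace n => C * (1 + ‖ξ‖) ^ (-m)) 2 volume).toNNReal, fun x => ?_⟩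
  rw [ENNReal.coe_toNNReal hL.2.ne]
  exact eLpNorm_mono_real (hC x)

theorem integral_exp_neg_inner_mul_eq_fourier (φ : 𝓢(RSpace n, ℂ)) (ξ : RSpace n) :
    ∫ y : RSpace n, Complex.exp (-(Complex.I * (inner ℝ y ξ : ℝ))) * φ y =
      FourierTransform.fourier φ ((2 * Real.pi)⁻¹ • ξ) := by
  rw [SchwartzMap.fourier_coe, Real.fourier_eq']
  refine integral_congr_ae (Eventually.of_forall fun y => ?_)
  simp only [smul_eq_mul, inner_smul_right]
  congr 2
  have hpi : (Real.pi : ℂ) ≠ 0 := by exact_mod_cast Real.pi_ne_zero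
  push_cast
  field_simp

theorem eLpNorm_two_fourier (φ : 𝓢(RSpace n, ℂ)) :
    eLpNorm (FourierTransform.fourier φ) 2 volume = eLpNorm φ 2 volume := by
  have hfin (ψ : 𝓢(RSpace n, ℂ)) : eLpNorm ψ 2 volume ≠ ⊤ := (ψ.memLp 2 volume).eLpNorm_ne_top
  have h := SchwartzMap.norm_fourier_toL2_eq φ
  rw [SchwartzMap.norm_toLp, SchwartzMap.norm_toLp] at h
  exact (ENNReal.toReal_eq_toReal_iff' (hfin _) (hfin _)).1 h

theorem exists_eLpNorm_two_fourier_comp_smul_eq (n : ℕ) {a : ℝ} (ha : a ≠ 0) :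
    ∃ C : ℝ≥0, ∀ φ : 𝓢(RSpace n, ℂ),
      eLpNorm (fun ξ => FourierTransform.fourier φ (a • ξ)) 2 volume = C * eLpNorm φ 2 volume := by
  refine ⟨Real.toNNReal |(a ^ Module.finrank ℝ (RSpace n))⁻¹| ^ (1 / 2 : ℝ≥0∞).toReal,
    fun φ => ?_⟩
  rw [eLpNorm_comp_smul volume ENNReal.ofNat_ne_top ha, eLpNorm_two_fourier, ENNReal.ofReal,
    ENNReal.coe_rpow_of_nonneg _ ENNReal.toReal_nonneg]

theorem exists_enorm_pseudoDiff_le {m : ℝ} (hm : n < 2 * m) {c : RSpace n → RSpace n → ℂ}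
    (hc : IsSymbol (-m) c) :
    ∃ C : ℝ≥0, ∀ (φ : 𝓢(RSpace n, ℂ)) (x : RSpace n),
      ‖pseudoDiff c φ x‖ₑ ≤ C * eLpNorm φ 2 volume := by
  obtain ⟨C, hC⟩ := hc.exists_eLpNorm_two_le hm
  obtain ⟨B, hB⟩ := exists_eLpNorm_two_fourier_comp_smul_eq n
    (inv_ne_zero Real.two_pi_pos.ne')
  refine ⟨‖(((2 * Real.pi) ^ n : ℝ) : ℂ)⁻¹‖₊ * (C * B), fun φ x => ?_⟩
  have hexp : Continuous fun ξ : RSpace n => Complex.exp (Complex.I * (inner ℝ x ξ : ℝ)) := by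
    fun_prop
  have hphase : eLpNorm (fun ξ => Complex.exp (Complex.I * (inner ℝ x ξ : ℝ)) * c x ξ) 2 volume =
      eLpNorm (c x) 2 volume :=
    eLpNorm_congr_norm_ae <| Eventually.of_forall fun ξ => by
      rw [norm_mul, mul_comm Complex.I, Complex.norm_exp_ofReal_mul_I, one_mul]
  have hint := enorm_integral_mul_le_eLpNorm_two_mul (ν := volume)
    (u := fun ξ => Complex.exp (Complex.I * (inner ℝ x ξ : ℝ)) * c x ξ)
    (v := fun ξ => FourierTransform.fourier φ ((2 * Real.pi)⁻¹ • ξ))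
    (hexp.mul (hc.continuous_right x)).aestronglyMeasurable
    ((FourierTransform.fourier φ).continuous.comp (continuous_const_smul _)).aestronglyMeasurable
  rw [hphase, hB, ← mul_assoc] at hint
  simp only [pseudoDiff, integral_exp_neg_inner_mul_eq_fourier]
  rw [enorm_mul, ENNReal.coe_mul, ENNReal.coe_mul, mul_assoc]
  exact mul_le_mul_right (hint.trans (by gcongr; exact hC x)) _

end PseudoDiff

/-- The second moments of the random distribution `f` are locally bounded on `L²`: for each compact
`K` there is a constant `C` with `(𝔼|⟨f, ψ⟩|²)^{1/2} ≤ C ‖ψ‖_{L²}` for all `ψ` vanishing off `K`. -/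
structure HasL2BoundedSecondMoments {n : ℕ} {Ω : Type*} [MeasurableSpace Ω] (P : Measure Ω)
    (f : Ω → 𝓢'(RSpace n, ℂ)) : Prop where
  aestronglyMeasurable : ∀ ψ : 𝓢(RSpace n, ℂ), AEStronglyMeasurable (fun w => f w ψ) P
  eLpNorm_le : ∀ K : Set (RSpace n), IsCompact K → ∃ C : ℝ≥0, ∀ ψ : 𝓢(RSpace n, ℂ),
    (∀ x ∉ K, ψ x = 0) → eLpNorm (fun w => f w ψ) 2 P ≤ C * eLpNorm ψ 2 volume

namespace IsMigrField

variable {n : ℕ} {Ω : Type*} [MeasurableSpace Ω] {P : Measure Ω} {f : Ω → 𝓢'(RSpace n, ℂ)}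
  {m : ℝ} {μ : RSpace n → ℝ} {D K : Set (RSpace n)}

theorem exists_enorm_mean_le (hf : IsMigrField P f m μ D) (hK : IsCompact K) :
    ∃ C : ℝ≥0, ∀ ψ : 𝓢(RSpace n, ℂ), (∀ x ∉ K, ψ x = 0) →
      ‖∫ w, f w ψ ∂P‖ₑ ≤ C * eLpNorm ψ 2 volume := by
  obtain ⟨g, hg_smooth, hg_supp, -, hg⟩ := hf.expectation
  obtain ⟨G, hG⟩ := hg_supp.exists_bound_of_continuous hg_smooth.continuous
  have hKfin : volume K ^ (1 / 2 : ℝ) ≠ ⊤ :=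
    ENNReal.rpow_ne_top_of_nonneg (by norm_num) hK.measure_lt_top.ne
  refine ⟨G.toNNReal * (volume K ^ (1 / 2 : ℝ)).toNNReal, fun ψ hψ => ?_⟩
  rw [hg, ENNReal.coe_mul, ENNReal.coe_toNNReal hKfin, mul_assoc,
    mul_comm (volume K ^ _)]
  refine enorm_integral_mul_le_of_eq_zero ψ.continuous.aestronglyMeasurable hψ fun x => ?_
  rw [← ofReal_norm]
  exact ENNReal.ofReal_le_ofReal (hG x)

theorem eLpNorm_sub_mean_sq (hf : IsMigrField P f m μ D) (ψ : 𝓢(RSpace n, ℂ)) :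
    eLpNorm (fun w => f w ψ - ∫ w', f w' ψ ∂P) 2 P ^ 2 =
      ‖covariancePairing P f (conjSchwartz ψ) ψ‖ₑ := by
  have := (hf.gaussian ψ).isProbabilityMeasure
  have hconj : conjSchwartz (conjSchwartz ψ) = ψ := by
    ext x
    simp [conjSchwartz]
  rw [covariancePairing, hconj]
  exact (enorm_integral_conj_mul_self ((hf.gaussian ψ).memLp_two.sub (memLp_const _))).symm

theorem exists_eLpNorm_sub_mean_le (hf : IsMigrField P f m μ D) (hm : n < 2 * m)
    (hK : IsCompact K) :
    ∃ C : ℝ≥0, ∀ ψ : 𝓢(RSpace n, ℂ), (∀ x ∉ K, ψ x = 0) →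
      eLpNorm (fun w => f w ψ - ∫ w', f w' ψ ∂P) 2 P ≤ C * eLpNorm ψ 2 volume := by
  obtain ⟨c, hc, -, hcov⟩ := hf.covariance
  obtain ⟨C, hC⟩ := exists_enorm_pseudoDiff_le hm hc
  have hKfin : volume K ^ (1 / 2 : ℝ) ≠ ⊤ :=
    ENNReal.rpow_ne_top_of_nonneg (by norm_num) hK.measure_lt_top.ne
  refine ⟨NNReal.sqrt (C * (volume K ^ (1 / 2 : ℝ)).toNNReal), fun ψ hψ => ?_⟩
  have hnorm : eLpNorm (conjSchwartz ψ) 2 volume = eLpNorm ψ 2 volume :=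
    eLpNorm_congr_norm_ae <| Eventually.of_forall fun x => by simp [conjSchwartz]
  rw [← ENNReal.pow_le_pow_left_iff two_ne_zero, hf.eLpNorm_sub_mean_sq, hcov, mul_pow,
    ← ENNReal.coe_pow, NNReal.sq_sqrt, ENNReal.coe_mul, ENNReal.coe_toNNReal hKfin]
  calc _ ≤ (C * eLpNorm ψ 2 volume) * (eLpNorm ψ 2 volume * volume K ^ (1 / 2 : ℝ)) :=
        enorm_integral_mul_le_of_eq_zero ψ.continuous.aestronglyMeasurable hψ
          fun x => (hC _ x).trans_eq (by rw [hnorm])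
    _ = _ := by ring

theorem hasL2BoundedSecondMoments (hf : IsMigrField P f m μ D) (hm : n < 2 * m) :
    HasL2BoundedSecondMoments P f where
  aestronglyMeasurable ψ := (hf.gaussian ψ).aemeasurable.aestronglyMeasurable
  eLpNorm_le K hK := by
    obtain ⟨A, hA⟩ := hf.exists_enorm_mean_le hK
    obtain ⟨B, hB⟩ := hf.exists_eLpNorm_sub_mean_le hm hK
    refine ⟨B + A, fun ψ hψ => ?_⟩
    have := (hf.gaussian ψ).isProbabilityMeasure
    have hmeas := (hf.gaussian ψ).aemeasurable.aestronglyMeasurable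
    calc eLpNorm (fun w => f w ψ) 2 P
        = eLpNorm ((fun w => f w ψ - ∫ w', f w' ψ ∂P) + fun _ => ∫ w', f w' ψ ∂P) 2 P := by
          simp only [Pi.add_def, sub_add_cancel]
      _ ≤ eLpNorm (fun w => f w ψ - ∫ w', f w' ψ ∂P) 2 P
            + eLpNorm (fun _ => ∫ w', f w' ψ ∂P) 2 P :=
          eLpNorm_add_le (hmeas.sub aestronglyMeasurable_const) aestronglyMeasurable_const
            one_le_two
      _ = eLpNorm (fun w => f w ψ - ∫ w', f w' ψ ∂P) 2 P + ‖∫ w', f w' ψ ∂P‖ₑ := by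
          rw [eLpNorm_const _ two_ne_zero (NeZero.ne P), measure_univ, ENNReal.one_rpow, mul_one]
      _ ≤ (B + A : ℝ≥0) * eLpNorm ψ 2 volume := by
          rw [ENNReal.coe_add, add_mul]
          exact add_le_add (hB ψ hψ) (hA ψ hψ)

end IsMigrField

/-! ### Separability of the space of test functions -/

section Separability

theorem secondCountableTopology_boundedContinuousFunction_zero_off {α β : Type*}
    [TopologicalSpace α] [R1Space α] [SecondCountableTopology α] [NormedAddCommGroup β]
    [SecondCountableTopology β] {K : Set α} (hK : IsCompact K) :
    SecondCountableTopology {h : α →ᵇ β // ∀ x ∉ K, h x = 0} := by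
  have := isCompact_iff_compactSpace.1 hK
  have hiso : Isometry fun h : {h : α →ᵇ β // ∀ x ∉ K, h x = 0} =>
      (h.1.toContinuousMap.restrict K : C(K, β)) := by
    refine Isometry.of_dist_eq fun g h => le_antisymm
      ((ContinuousMap.dist_le dist_nonneg).2 fun x => BoundedContinuousFunction.dist_coe_le_dist _)
      ((BoundedContinuousFunction.dist_le dist_nonneg).2 fun x => ?_)
    by_cases hx : x ∈ K
    · exact ContinuousMap.dist_apply_le_dist (f := g.1.toContinuousMap.restrict K)
        (g := h.1.toContinuousMap.restrict K) ⟨x, hx⟩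
    · rw [g.2 x hx, h.2 x hx, dist_self]
      exact dist_nonneg
  exact hiso.isEmbedding.isInducing.secondCountableTopology

variable {E F : Type*} [NormedAddCommGroup E] [NormedSpace ℝ E] [FiniteDimensional ℝ E]
  [NormedAddCommGroup F] [NormedSpace ℝ F] [FiniteDimensional ℝ F]

variable (E F) in
theorem secondCountableTopology_continuousMultilinearMap (i : ℕ) :
    SecondCountableTopology (E [×i]→L[ℝ] F) := by
  have : FiniteDimensional ℝ (E [×i]→L[ℝ] F) :=
    .of_injective (ContinuousMultilinearMap.toMultilinearMapLinear :
      (E [×i]→L[ℝ] F) →ₗ[ℝ] MultilinearMap ℝ (fun _ : Fin i => E) F)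
      ContinuousMultilinearMap.toMultilinearMap_injective
  have : ProperSpace (E [×i]→L[ℝ] F) := FiniteDimensional.proper ℝ _
  infer_instance

instance secondCountableTopology_contDiffMapSupportedIn (K : Compacts E) :
    SecondCountableTopology 𝓓_{K}(E, F) := by
  have : ProperSpace E := FiniteDimensional.proper ℝ E
  have hjet (i : ℕ) (f : 𝓓_{K}(E, F)) (x : E) (hx : x ∉ K) :
      ContDiffMapSupportedIn.structureMapCLM ℝ ⊤ i f x = 0 := by
    rw [ContDiffMapSupportedIn.structureMapCLM_top_apply]
    exact f.iteratedFDeriv_zero_on_compl hx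
  let jet (f : 𝓓_{K}(E, F)) (i : ℕ) : {h : E →ᵇ E [×i]→L[ℝ] F // ∀ x ∉ K, h x = 0} :=
    ⟨ContDiffMapSupportedIn.structureMapCLM ℝ ⊤ i f, hjet i f⟩
  have hind : IsInducing fun f i => (jet f i).1 :=
    (ContDiffMapSupportedIn.isUniformEmbedding_pi_structureMapCLM ℝ).isEmbedding.isInducing
  have hjet_ind : IsInducing jet := by
    have hval : Continuous fun (h : ∀ i, {h : E →ᵇ E [×i]→L[ℝ] F // ∀ x ∉ K, h x = 0}) i =>
      (h i).1 := by fun_prop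
    exact .of_comp (continuous_pi fun i =>
      ((continuous_apply i).comp hind.continuous).subtype_mk _) hval hind
  have (i : ℕ) : SecondCountableTopology {h : E →ᵇ E [×i]→L[ℝ] F // ∀ x ∉ K, h x = 0} :=
    have := secondCountableTopology_continuousMultilinearMap E F i
    secondCountableTopology_boundedContinuousFunction_zero_off K.isCompact
  exact hjet_ind.secondCountableTopology

instance separableSpace_testFunction (Ω : Opens E) : SeparableSpace 𝓓(Ω, F) := by
  have : ProperSpace E := FiniteDimensional.proper ℝ E
  have : LocallyCompactSpace Ω := Ω.isOpen.locallyCompactSpace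
  let S := CompactExhaustion.choice Ω
  let K (n : ℕ) : Compacts E := ⟨Subtype.val '' S n, (S.isCompact n).image continuous_subtype_val⟩
  have hKΩ (n : ℕ) : (K n : Set E) ⊆ Ω := Subtype.coe_image_subset _ _
  have hcover : (Set.univ : Set 𝓓(Ω, F)) ⊆
      ⋃ n, Set.range (TestFunction.ofSupportedIn (F := F) (n := ⊤) (hKΩ n)) := fun φ _ => by
    obtain ⟨n, hn⟩ := S.exists_superset_of_isCompact
      (IsInducing.subtypeVal.isCompact_preimage' φ.hasCompactSupport
        (φ.tsupport_subset.trans Subtype.range_val.ge))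
    have hφ : Function.support φ ⊆ K n := fun x hx =>
      ⟨⟨x, φ.tsupport_subset (subset_tsupport φ hx)⟩, hn (subset_tsupport φ hx), rfl⟩
    exact Set.mem_iUnion.2 ⟨n, .of_support_subset φ.contDiff hφ, rfl⟩
  rw [← isSeparable_univ_iff]
  exact (IsSeparable.iUnion fun n =>
    isSeparable_range (TestFunction.continuous_ofSupportedIn (hKΩ n))).mono hcover

end Separability

/-! ### Continuous operators on test functions -/

section ToSchwartz

variable {E F : Type*} [NormedAddCommGroup E] [NormedSpace ℝ E] [NormedAddCommGroup F]
  [NormedSpace ℝ F] [NormedSpace ℂ F] [SMulCommClass ℝ ℂ F]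

/-- The inclusion of the smooth functions supported in `K` into the Schwartz functions. -/
def supportedInToSchwartzCLM (K : Compacts E) : 𝓓_{K}(E, F) →L[ℂ] 𝓢(E, F) where
  toFun f := f.compact_supp.toSchwartzMap f.contDiff
  map_add' _ _ := rfl
  map_smul' _ _ := rfl
  cont := by
    obtain ⟨R, hR⟩ := K.isCompact.isBounded.exists_norm_le
    refine (ContDiffMapSupportedIn.withSeminorms ℂ E F ⊤ K).continuous_of_isBounded
      (schwartz_withSeminorms ℂ E F)
      (⟨⟨fun f => f.compact_supp.toSchwartzMap f.contDiff, fun _ _ => rfl⟩, fun _ _ => rfl⟩ :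
        𝓓_{K}(E, F) →ₗ[ℂ] 𝓢(E, F))
      (.of_real fun ⟨k, i⟩ => ⟨{i}, |R| ^ k, fun f =>
        SchwartzMap.seminorm_le_bound ℂ k i _ (by positivity) fun x => ?_⟩)
    rw [Finset.sup_singleton]
    by_cases hx : x ∈ K
    · gcongr
      · exact (hR x hx).trans (le_abs_self R)
      · exact f.norm_iteratedFDeriv_apply_le_seminorm_top ℂ
    · have h0 : iteratedFDeriv ℝ i f x = 0 := f.iteratedFDeriv_zero_on_compl hx
      change ‖x‖ ^ k * ‖iteratedFDeriv ℝ i f x‖ ≤ _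
      rw [h0, norm_zero, mul_zero]
      positivity

/-- The inclusion of the test functions into the Schwartz functions. -/
def testFunctionToSchwartzCLM (Ω : Opens E) : 𝓓(Ω, F) →L[ℂ] 𝓢(E, F) :=
  TestFunction.limitCLM ℂ (fun f => f.hasCompactSupport.toSchwartzMap f.contDiff)
    (fun K _ => supportedInToSchwartzCLM K) fun _ _ _ => rfl

end ToSchwartz

section Convolution

universe u

variable {G : Type u} [NormedAddCommGroup G] [NormedSpace ℝ G] [FiniteDimensional ℝ G]
  [MeasurableSpace G] [BorelSpace G] {ν : Measure G} [ν.IsAddHaarMeasure]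
  {E' : Type u} [NormedAddCommGroup E'] [NormedSpace ℝ E']
  {g : G → E'} {K₁ K₂ : Set G} {S : ℝ} {x : G}

theorem norm_convolution_le_of_tsupport_subset {E F : Type u} [NormedAddCommGroup E]
    [NormedSpace ℝ E] [NormedAddCommGroup F] [NormedSpace ℝ F] (L : E →L[ℝ] E' →L[ℝ] F) {φ : G → E}
    (hg : LocallyIntegrable g ν) (hK₁ : IsCompact K₁) (hK₂ : IsCompact K₂) (hφ : tsupport φ ⊆ K₁)
    (hS : ∀ t, ‖φ t‖ ≤ S) (hx : x ∈ K₂) :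
    ‖(φ ⋆[L, ν] g) x‖ ≤ ‖L‖ * S * ∫ z in K₂ - K₁, ‖g z‖ ∂ν := by
  have hS0 : 0 ≤ S := (norm_nonneg _).trans (hS 0)
  have hK : IsCompact (K₂ - K₁) := by
    simpa only [Set.sub_image_prod] using (hK₂.prod hK₁).image continuous_sub
  have hgi : Integrable ((K₂ - K₁).indicator fun z => ‖g z‖) ν :=
    (integrable_indicator_iff hK.measurableSet).2 (hg.integrableOn_isCompact hK).norm
  rw [← integral_indicator hK.measurableSet,
    ← integral_sub_left_eq_self ((K₂ - K₁).indicator fun z => ‖g z‖) ν x, ← integral_const_mul]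
  refine norm_integral_le_of_norm_le ((hgi.comp_sub_left x).const_mul _)
    (Eventually.of_forall fun t => ?_)
  by_cases ht : t ∈ tsupport φ
  · rw [Set.indicator_of_mem (Set.sub_mem_sub hx (hφ ht))]
    exact (L.le_opNorm₂ _ _).trans (by gcongr; exact hS t)
  · rw [image_eq_zero_of_notMem_tsupport ht, map_zero, zero_apply, norm_zero]
    exact mul_nonneg (by positivity) (Set.indicator_nonneg (fun _ _ => norm_nonneg _) _)

theorem norm_iteratedFDeriv_convolution_le (hg : LocallyIntegrable g ν) (hK₁ : IsCompact K₁)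
    (hK₂ : IsCompact K₂) (hx : x ∈ K₂) (j : ℕ) :
    ∀ {E F : Type u} [NormedAddCommGroup E] [NormedSpace ℝ E] [NormedAddCommGroup F]
      [NormedSpace ℝ F] (L : E →L[ℝ] E' →L[ℝ] F) {φ : G → E}, ContDiff ℝ ∞ φ → tsupport φ ⊆ K₁ →
      (∀ t, ‖iteratedFDeriv ℝ j φ t‖ ≤ S) →
      ‖iteratedFDeriv ℝ j (φ ⋆[L, ν] g) x‖ ≤ ‖L‖ * S * ∫ z in K₂ - K₁, ‖g z‖ ∂ν := by
  induction j with
  | zero =>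
    intro E F _ _ _ _ L φ _ hφK hS
    rw [norm_iteratedFDeriv_zero]
    exact norm_convolution_le_of_tsupport_subset L hg hK₁ hK₂ hφK (by simpa using hS) hx
  | succ j ih =>
    intro E F _ _ _ _ L φ hφ hφK hS
    have hS0 : 0 ≤ S := (norm_nonneg _).trans (hS 0)
    have hφc : HasCompactSupport φ := hK₁.of_isClosed_subset (isClosed_tsupport φ) hφK
    have hfderiv : fderiv ℝ (φ ⋆[L, ν] g) = fderiv ℝ φ ⋆[L.precompL G, ν] g := by
      ext1 y
      exact (hφc.hasFDerivAt_convolution_left L (hφ.of_le (mod_cast le_top)) hg y).fderiv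
    rw [← norm_iteratedFDeriv_fderiv, hfderiv]
    refine (ih (L.precompL G) (hφ.fderiv_right (by simp)) ((tsupport_fderiv_subset ℝ).trans hφK)
      fun t => ?_).trans ?_
    · rw [norm_iteratedFDeriv_fderiv]
      exact hS t
    · gcongr
      exact L.norm_precompL_le G

end Convolution

section CutoffConvolution

variable {G : Type} [NormedAddCommGroup G] [NormedSpace ℝ G] [FiniteDimensional ℝ G]
  [MeasurableSpace G] [BorelSpace G] {ν : Measure G} [ν.IsAddHaarMeasure] {g : G → ℂ}
  {K₁ K₂ : Compacts G}

theorem contDiff_mul_convolution (hg : LocallyIntegrable g ν) (χ : 𝓓_{K₂}(G, ℂ))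
    (φ : 𝓓_{K₁}(G, ℂ)) : ContDiff ℝ ∞ fun x => χ x * (φ ⋆[.mul ℝ ℂ, ν] g) x :=
  χ.contDiff.mul (φ.compact_supp.contDiff_convolution_left _ φ.contDiff hg)

theorem norm_iteratedFDeriv_mul_convolution_le (hg : LocallyIntegrable g ν) (χ : 𝓓_{K₂}(G, ℂ))
    (φ : 𝓓_{K₁}(G, ℂ)) (i : ℕ) {x : G} (hx : x ∈ K₂) :
    ‖iteratedFDeriv ℝ i (fun x => χ x * (φ ⋆[.mul ℝ ℂ, ν] g) x) x‖ ≤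
      (∑ j ∈ Finset.range (i + 1), i.choose j * N[ℂ]_{K₂, ⊤, j} χ *
        ∫ z in (K₂ : Set G) - (K₁ : Set G), ‖g z‖ ∂ν) *
        ((Finset.range (i + 1)).sup fun j => N[ℂ]_{K₁, ⊤, j}) φ := by
  refine (norm_iteratedFDeriv_mul_le (𝕜 := ℝ) (n := i) (N := ∞) χ.contDiff
    (φ.compact_supp.contDiff_convolution_left _ φ.contDiff hg) x (mod_cast le_top)).trans ?_
  rw [Finset.sum_mul]
  refine Finset.sum_le_sum fun j _ => ?_
  have hconv : ‖iteratedFDeriv ℝ (i - j) (φ ⋆[.mul ℝ ℂ, ν] g) x‖ ≤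
      ‖ContinuousLinearMap.mul ℝ ℂ‖ * N[ℂ]_{K₁, ⊤, i - j} φ *
        ∫ z in (K₂ : Set G) - (K₁ : Set G), ‖g z‖ ∂ν :=
    norm_iteratedFDeriv_convolution_le hg K₁.isCompact K₂.isCompact hx (i - j) _ φ.contDiff
      φ.tsupport_subset fun _ => φ.norm_iteratedFDeriv_apply_le_seminorm_top ℂ
  have hsup : N[ℂ]_{K₁, ⊤, i - j} φ ≤ ((Finset.range (i + 1)).sup fun j => N[ℂ]_{K₁, ⊤, j}) φ :=
    Seminorm.le_def.1 (Finset.le_sup (f := fun j => N[ℂ]_{K₁, ⊤, j})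
      (Finset.mem_range.2 (by lia : i - j < i + 1))) φ
  rw [ContinuousLinearMap.opNorm_mul, one_mul] at hconv
  calc _ ≤ i.choose j * N[ℂ]_{K₂, ⊤, j} χ *
        (((Finset.range (i + 1)).sup fun j => N[ℂ]_{K₁, ⊤, j}) φ *
          ∫ z in (K₂ : Set G) - (K₁ : Set G), ‖g z‖ ∂ν) := by
        gcongr
        · exact χ.norm_iteratedFDeriv_apply_le_seminorm_top ℂ
        · exact hconv.trans (by gcongr)
    _ = _ := by ring

/-- The operator `φ ↦ χ · (φ ⋆ g)` on the smooth functions supported in `K₁`. -/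
def cutoffConvolutionSupportedInCLM (hg : LocallyIntegrable g ν) (χ : 𝓓_{K₂}(G, ℂ)) :
    𝓓_{K₁}(G, ℂ) →L[ℂ] 𝓓_{K₂}(G, ℂ) :=
  ContDiffMapSupportedIn.mkCLM ℂ (fun φ x => χ x * (φ ⋆[.mul ℝ ℂ, ν] g) x)
    (fun φ ψ x => by
      have hconv (θ : 𝓓_{K₁}(G, ℂ)) : ConvolutionExistsAt θ g x (.mul ℝ ℂ) ν :=
        θ.compact_supp.convolutionExists_left _ θ.contDiff.continuous hg x
      rw [← mul_add, ← (hconv φ).add_distrib (hconv ψ)]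
      rfl)
    (fun c φ x => by
      have hsmul : (⇑(c • φ) ⋆[.mul ℝ ℂ, ν] g) x = c • (φ ⋆[.mul ℝ ℂ, ν] g) x := by
        simp only [convolution_def, ContinuousLinearMap.mul_apply', ← integral_smul]
        simp [mul_assoc]
      rw [hsmul, mul_smul_comm])
    (fun φ => contDiff_mul_convolution hg χ φ)
    (fun φ x hx => by simp [χ.zero_on_compl hx])
    fun i _ => ⟨Finset.range (i + 1), _,
      Finset.sum_nonneg fun j _ => mul_nonneg (by positivity) (by positivity),
      fun φ x hx => norm_iteratedFDeriv_mul_convolution_le hg χ φ i hx⟩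

/-- The operator `φ ↦ χ · (φ ⋆ g)` from the test functions to the Schwartz functions. -/
def cutoffConvolutionCLM (hg : LocallyIntegrable g ν) (χ : 𝓓_{K₂}(G, ℂ)) :
    𝓓((⊤ : Opens G), ℂ) →L[ℂ] 𝓢(G, ℂ) :=
  TestFunction.limitCLM ℂ
    (fun φ => (χ.compact_supp.mul_right : HasCompactSupport
      fun x => χ x * (φ ⋆[.mul ℝ ℂ, ν] g) x).toSchwartzMap
      (χ.contDiff.mul (φ.hasCompactSupport.contDiff_convolution_left _ φ.contDiff hg)))
    (fun _ _ => supportedInToSchwartzCLM K₂ ∘L cutoffConvolutionSupportedInCLM hg χ)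
    fun _ _ _ => rfl

end CutoffConvolution

/-! ### Weighted `L²` spaces and duality -/

section Weight

variable {n : ℕ} {δ δ' : ℝ} {g u : RSpace n → ℂ}

/-- The weight `⟨x⟩^δ = (1 + |x|²)^{δ/2}` of the space `L²_δ`. -/
def weight (δ : ℝ) (x : RSpace n) : ℝ :=
  (1 + ‖x‖ ^ 2) ^ (δ / 2)

theorem weight_pos (δ : ℝ) (x : RSpace n) : 0 < weight δ x := by
  unfold weight
  positivity

theorem continuous_weight (δ : ℝ) : Continuous (weight δ : RSpace n → ℝ) :=
  Continuous.rpow_const (by fun_prop) fun x => Or.inl (by positivity)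

theorem weight_neg (δ : ℝ) (x : RSpace n) : weight (-δ) x = (weight δ x)⁻¹ := by
  rw [weight, neg_div, Real.rpow_neg (by positivity), weight]

theorem weight_mono (h : δ ≤ δ') (x : RSpace n) : weight δ x ≤ weight δ' x :=
  Real.rpow_le_rpow_of_exponent_le (by simp) (by linarith)

theorem one_add_sq_norm_le_mul (x y : RSpace n) :
    1 + ‖x‖ ^ 2 ≤ 2 * (1 + ‖y‖ ^ 2) * (1 + ‖y - x‖ ^ 2) := by
  have h : ‖x‖ ^ 2 ≤ (‖y‖ + ‖y - x‖) ^ 2 := by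
    gcongr
    simpa using norm_sub_le y (y - x)
  nlinarith [sq_nonneg (‖y‖ - ‖y - x‖), sq_nonneg (‖y‖ * ‖y - x‖)]

-- Peetre's inequality
theorem weight_le_mul_weight_sub (δ : ℝ) (x y : RSpace n) :
    weight δ x ≤ 2 ^ (|δ| / 2) * weight |δ| y * weight δ (y - x) := by
  have hpos (δ : ℝ) (hδ : 0 ≤ δ) (x y : RSpace n) :
      weight δ x ≤ 2 ^ (δ / 2) * weight δ y * weight δ (y - x) := by
    simp only [weight]
    rw [← Real.mul_rpow (by positivity) (by positivity),
      ← Real.mul_rpow (by positivity) (by positivity)]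
    exact Real.rpow_le_rpow (by positivity) (one_add_sq_norm_le_mul x y) (by positivity)
  rcases le_total 0 δ with hδ | hδ
  · simpa only [abs_of_nonneg hδ] using hpos δ hδ x y
  · have h := hpos (-δ) (neg_nonneg.2 hδ) (y - x) y
    rw [sub_sub_cancel] at h
    rw [abs_of_nonpos hδ, ← neg_neg δ, weight_neg (-δ) x, weight_neg (-δ) (y - x), neg_neg,
      ← div_eq_mul_inv, inv_eq_one_div, div_le_div_iff₀ (weight_pos _ _) (weight_pos _ _), one_mul]
    exact h

theorem MemWeightedL2.locallyIntegrable (hu : MemWeightedL2 δ u) : LocallyIntegrable u volume :=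
  hu.1

theorem MemWeightedL2.memLp_weight_mul (hu : MemWeightedL2 δ u) :
    MemLp (fun x => (weight δ x : ℂ) * u x) 2 volume :=
  hu.2

theorem MemWeightedL2.mono (h : δ ≤ δ') (hu : MemWeightedL2 δ' u) : MemWeightedL2 δ u := by
  refine ⟨hu.locallyIntegrable, hu.memLp_weight_mul.mono ?_ (Eventually.of_forall fun x => ?_)⟩
  · exact (Complex.continuous_ofReal.comp (continuous_weight δ)).aestronglyMeasurable.mul
      hu.locallyIntegrable.aestronglyMeasurable
  · change ‖(weight δ x : ℂ) * u x‖ ≤ _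
    rw [norm_mul, norm_mul, Complex.norm_real, Complex.norm_real,
      Real.norm_of_nonneg (weight_pos δ x).le, Real.norm_of_nonneg (weight_pos δ' x).le]
    gcongr
    exact weight_mono h x

theorem exists_eLpNorm_weight_mul_comp_sub_left_le (hg : MemWeightedL2 δ g) {K : Set (RSpace n)}
    (hK : IsCompact K) :
    ∃ C : ℝ≥0∞, C ≠ ⊤ ∧ ∀ y ∈ K, eLpNorm (fun x => (weight δ x : ℂ) * g (y - x)) 2 volume ≤ C := by
  obtain ⟨M, hM⟩ := hK.exists_bound_of_continuousOn (continuous_weight |δ|).continuousOn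
  refine ⟨ENNReal.ofReal (2 ^ (|δ| / 2) * M) * eLpNorm (fun x => (weight δ x : ℂ) * g x) 2 volume,
    ENNReal.mul_ne_top ENNReal.ofReal_ne_top hg.memLp_weight_mul.2.ne, fun y hy => ?_⟩
  rw [← eLpNorm_comp_measurePreserving hg.memLp_weight_mul.1
    (Measure.measurePreserving_sub_left volume y)]
  refine eLpNorm_le_mul_eLpNorm_of_ae_le_mul (Eventually.of_forall fun x => ?_) 2
  rw [Function.comp_apply, norm_mul, norm_mul, ← mul_assoc, Complex.norm_real, Complex.norm_real,
    Real.norm_of_nonneg (weight_pos δ _).le, Real.norm_of_nonneg (weight_pos _ _).le]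
  gcongr
  refine (weight_le_mul_weight_sub δ x y).trans ?_
  gcongr
  · exact (weight_pos _ _).le
  · exact (le_abs_self _).trans (hM y hy)

theorem MemWeightedL2.comp_sub_left (hg : MemWeightedL2 δ g) (y : RSpace n) :
    MemWeightedL2 δ fun x => g (y - x) := by
  obtain ⟨C, hC, hle⟩ :=
    exists_eLpNorm_weight_mul_comp_sub_left_le hg (isCompact_singleton (x := y))
  have hloc : LocallyIntegrable (fun x => g (y - x)) volume := by
    refine (locallyIntegrable_map_homeomorph (Homeomorph.subLeft y)).1 ?_
    exact (Measure.measurePreserving_sub_left volume y).map_eq.symm ▸ hg.locallyIntegrable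
  exact ⟨hloc, ((Complex.continuous_ofReal.comp
    (continuous_weight δ)).aestronglyMeasurable.mul hloc.aestronglyMeasurable),
    (hle y rfl).trans_lt hC.lt_top⟩

theorem hasTemperateGrowth_weight (δ : ℝ) :
    Function.HasTemperateGrowth fun x : RSpace n => (weight δ x : ℂ) :=
  Complex.ofRealCLM.hasTemperateGrowth.comp
    (Function.hasTemperateGrowth_one_add_norm_sq_rpow (RSpace n) (δ / 2))

/-- The embedding `φ ↦ ⟨x⟩^δ φ` of the Schwartz functions into `L²`. -/
def weightedToL2CLM (n : ℕ) (δ : ℝ) : 𝓢(RSpace n, ℂ) →L[ℂ] Lp ℂ 2 (volume : Measure (RSpace n)) :=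
  SchwartzMap.toLpCLM ℂ ℂ 2 volume ∘L SchwartzMap.smulLeftCLM ℂ fun x => (weight δ x : ℂ)

theorem coeFn_weightedToL2CLM (δ : ℝ) (φ : 𝓢(RSpace n, ℂ)) :
    weightedToL2CLM n δ φ =ᵐ[volume] fun x => (weight δ x : ℂ) * φ x := by
  refine (SchwartzMap.coeFn_toLp _ 2 volume).trans (Eventually.of_forall fun x => ?_)
  exact SchwartzMap.smulLeftCLM_apply_apply (hasTemperateGrowth_weight δ) φ x

theorem injective_weightedToL2CLM (n : ℕ) (δ : ℝ) : Function.Injective (weightedToL2CLM n δ) := by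
  refine (SchwartzMap.injective_toLp (F := ℂ) 2 (volume : Measure (RSpace n))).comp
    fun φ ψ hφψ => ?_
  ext x
  have h : SchwartzMap.smulLeftCLM ℂ (fun x => (weight δ x : ℂ)) φ x =
      SchwartzMap.smulLeftCLM ℂ (fun x => (weight δ x : ℂ)) ψ x := DFunLike.congr_fun hφψ x
  simp only [SchwartzMap.smulLeftCLM_apply_apply (hasTemperateGrowth_weight δ), smul_eq_mul] at h
  exact mul_left_cancel₀ (Complex.ofReal_ne_zero.2 (weight_pos δ x).ne') h

theorem integral_mul_eq_inner_weightedToL2CLM {h : Lp ℂ 2 (volume : Measure (RSpace n))}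
    (hu : h =ᵐ[volume] fun x => conj ((weight δ x : ℂ) * u x)) (φ : 𝓢(RSpace n, ℂ)) :
    ∫ x, u x * φ x = inner ℂ h (weightedToL2CLM n (-δ) φ) := by
  rw [L2.inner_def]
  refine integral_congr_ae ?_
  filter_upwards [hu, coeFn_weightedToL2CLM (-δ) φ] with x hx hφx
  have hw : (weight δ x : ℂ) ≠ 0 := Complex.ofReal_ne_zero.2 (weight_pos δ x).ne'
  rw [hx, hφx, RCLike.inner_apply, Complex.conj_conj, weight_neg, Complex.ofReal_inv]
  field_simp

theorem exists_memWeightedL2_integral_mul_eq_inner (δ : ℝ)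
    (h : Lp ℂ 2 (volume : Measure (RSpace n))) :
    ∃ u, MemWeightedL2 δ u ∧
      ∀ φ : 𝓢(RSpace n, ℂ), ∫ x, u x * φ x = inner ℂ h (weightedToL2CLM n (-δ) φ) := by
  have hcancel (x : RSpace n) :
      (weight δ x : ℂ) * ((weight (-δ) x : ℂ) * conj (h x)) = conj (h x) := by
    have hw : (weight δ x : ℂ) ≠ 0 := Complex.ofReal_ne_zero.2 (weight_pos δ x).ne'
    rw [weight_neg, Complex.ofReal_inv, mul_inv_cancel_left₀ hw]
  have hh : MemLp (fun x => conj (h x)) 2 (volume : Measure (RSpace n)) := (Lp.memLp h).star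
  refine ⟨fun x => (weight (-δ) x : ℂ) * conj (h x), ⟨?_, ?_⟩, fun φ =>
    integral_mul_eq_inner_weightedToL2CLM (Eventually.of_forall fun x => ?_) φ⟩
  · have hloc := (hh.locallyIntegrable one_le_two).locallyIntegrableOn Set.univ
    rw [← locallyIntegrableOn_univ]
    exact hloc.continuousOn_mul (Complex.continuous_ofReal.comp
      (continuous_weight (-δ))).continuousOn isOpen_univ.isLocallyClosed
  · exact hh.ae_eq (Eventually.of_forall fun x => (hcancel x).symm)
  · simp only [hcancel, Complex.conj_conj]

theorem tsum_enorm_integral_mul_sq_le (hu : MemWeightedL2 δ u) {ι : Type*} {v : ι → 𝓢(RSpace n, ℂ)}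
    (hv : Orthonormal ℂ fun i => weightedToL2CLM n (-δ) (v i)) :
    ∑' i, ‖∫ x, u x * v i x‖ₑ ^ 2 ≤ eLpNorm (fun x => (weight δ x : ℂ) * u x) 2 volume ^ 2 := by
  set h := hu.memLp_weight_mul.star.toLp
  have hnorm : ‖h‖ₑ = eLpNorm (fun x => (weight δ x : ℂ) * u x) 2 volume :=
    (Lp.enorm_toLp _).trans eLpNorm_star
  have hinner (i : ι) : ‖∫ x, u x * v i x‖ₑ ^ 2 =
      ENNReal.ofReal (‖inner ℂ (weightedToL2CLM n (-δ) (v i)) h‖ ^ 2) := by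
    rw [integral_mul_eq_inner_weightedToL2CLM hu.memLp_weight_mul.star.coeFn_toLp, norm_inner_symm,
      ENNReal.ofReal_pow (norm_nonneg _), ofReal_norm]
  simp only [hinner]
  rw [← ENNReal.ofReal_tsum_of_nonneg (fun i => by positivity) (hv.inner_products_summable _),
    ← hnorm, ← ofReal_norm, ← ENNReal.ofReal_pow (norm_nonneg _)]
  exact ENNReal.ofReal_le_ofReal (hv.tsum_inner_products_le _)

end Weight

/-! ### Random functionals represented in a Hilbert space -/

section HilbertSpace

variable {𝕜 V H : Type*} [RCLike 𝕜] [AddCommGroup V] [Module 𝕜 V] [NormedAddCommGroup H]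
  [InnerProductSpace 𝕜 H]

theorem exists_countable_orthonormal_range_subset_span (J : V →ₗ[𝕜] H) (hJ : Function.Injective J)
    (u : ℕ → V) :
    ∃ s : Set V, s.Countable ∧ Orthonormal 𝕜 (fun v : s => J v) ∧
      Set.range u ⊆ Submodule.span 𝕜 s := by
  set e : ℕ → H := InnerProductSpace.gramSchmidtNormed 𝕜 (J ∘ u)
  have hspan : Submodule.span 𝕜 (Set.range e \ {0}) = (Submodule.span 𝕜 (Set.range u)).map J := by
    rw [Submodule.span_sdiff_singleton_zero, InnerProductSpace.span_gramSchmidtNormed_range,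
      InnerProductSpace.span_gramSchmidt, Set.range_comp, Submodule.map_span]
  have hrange : Set.range e \ {0} ⊆ Set.range J := fun x hx =>
    LinearMap.map_le_range (hspan ▸ Submodule.subset_span hx)
  have hsub : Orthonormal 𝕜 ((↑) : ↥(Set.range e \ {0}) → H) := by
    have h := (InnerProductSpace.gramSchmidtNormed_orthonormal' (𝕜 := 𝕜) (J ∘ u)).toSubtypeRange
    have hset : Set.range e \ {0} = Set.range fun i : {i // e i ≠ 0} => e i := by
      ext x
      aesop
    rw [hset]
    exact h
  refine ⟨J ⁻¹' (Set.range e \ {0}),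
    ((Set.countable_range e).mono Set.sdiff_subset).preimage_of_injOn hJ.injOn,
    hsub.comp _ (Set.restrictPreimage_injective _ hJ), ?_⟩
  have hmap : (Submodule.span 𝕜 (J ⁻¹' (Set.range e \ {0}))).map J =
      (Submodule.span 𝕜 (Set.range u)).map J := by
    rw [Submodule.map_span, Set.image_preimage_eq_of_subset hrange, hspan]
  rw [Submodule.map_injective_of_injective hJ hmap]
  exact Submodule.subset_span

-- the Riesz–Fischer theorem
theorem exists_inner_eq_of_orthonormal [CompleteSpace H] {ι : Type*} {e : ι → H}
    (he : Orthonormal 𝕜 e) {a : ι → 𝕜} (ha : Summable fun i => ‖a i‖ ^ 2) :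
    ∃ h : H, ∀ i, inner 𝕜 h (e i) = a i := by
  classical
  have hmem : Memℓp (fun i => conj (a i)) 2 := memℓp_gen (by simpa using ha)
  refine ⟨he.orthogonalFamily.linearIsometry ⟨_, hmem⟩, fun i => ?_⟩
  have hei : he.orthogonalFamily.linearIsometry (lp.single 2 i (1 : 𝕜)) = e i := by simp
  rw [← hei, LinearIsometry.inner_map_map, lp.inner_single_right]
  simp

end HilbertSpace

section RandomFunctional

variable {𝕜 V H Ω : Type*} [RCLike 𝕜] [AddCommGroup V] [Module 𝕜 V] [TopologicalSpace V]
  [NormedAddCommGroup H] [InnerProductSpace 𝕜 H]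

theorem eq_inner_of_eqOn_of_dense_span {ℓ : V →L[𝕜] 𝕜} {J : V →L[𝕜] H} {h : H} {s : Set V}
    (hs : Dense (Submodule.span 𝕜 s : Set V)) (hℓ : ∀ v ∈ s, ℓ v = inner 𝕜 h (J v)) (v : V) :
    ℓ v = inner 𝕜 h (J v) := by
  have h : ℓ = innerSL 𝕜 h ∘L J := ContinuousLinearMap.ext_on hs hℓ
  rw [h]
  rfl

theorem ae_exists_forall_eq_inner [SeparableSpace V] [CompleteSpace H] [MeasurableSpace Ω]
    {P : Measure Ω} {ℓ : Ω → V →L[𝕜] 𝕜} {J : V →L[𝕜] H} (hJ : Function.Injective J)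
    (hℓ : ∀ v, AEStronglyMeasurable (fun w => ℓ w v) P)
    (hsum : ∀ s : Set V, s.Countable → Orthonormal 𝕜 (fun v : s => J v) →
      ∑' v : s, ∫⁻ w, ‖ℓ w v‖ₑ ^ 2 ∂P ≠ ⊤) :
    ∀ᵐ w ∂P, ∃ h : H, ∀ v, ℓ w v = inner 𝕜 h (J v) := by
  obtain ⟨s, hs, hortho, hspan⟩ :=
    exists_countable_orthonormal_range_subset_span J.toLinearMap hJ (denseSeq V)
  have : Countable s := hs
  have hmeas (v : s) : AEMeasurable (fun w => ‖ℓ w v‖ₑ ^ 2) P := (hℓ v).enorm.pow_const 2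
  have hfin : ∀ᵐ w ∂P, ∑' v : s, ‖ℓ w v‖ₑ ^ 2 < ⊤ := by
    refine ae_lt_top' (AEMeasurable.tsum hmeas) ?_
    rw [lintegral_tsum hmeas]
    exact hsum s hs hortho
  filter_upwards [hfin] with w hw
  obtain ⟨h, hh⟩ := exists_inner_eq_of_orthonormal hortho (a := fun v => ℓ w v)
    (by simpa using ENNReal.summable_toReal hw.ne)
  exact ⟨h, eq_inner_of_eqOn_of_dense_span ((denseRange_denseSeq V).mono hspan)
    fun v hv => (hh ⟨v, hv⟩).symm⟩

end RandomFunctional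

/-! ### Convolution of a random distribution with a weighted `L²` function -/

section RandomConvolution

variable {n : ℕ} {δ : ℝ} {g : RSpace n → ℂ} {K : Compacts (RSpace n)}

theorem cutoffConvolutionCLM_apply (hg : LocallyIntegrable g volume) (χ : 𝓓_{K}(RSpace n, ℂ))
    (φ : 𝓓((⊤ : Opens (RSpace n)), ℂ)) (y : RSpace n) :
    cutoffConvolutionCLM hg χ φ y = χ y * ∫ x, g (y - x) * φ x := by
  simp only [mul_comm (g _)]
  rfl

-- `φ ↦ χ (φ ⋆ g)` is a Hilbert–Schmidt operator from `L²_{-δ}` to `L²`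
theorem tsum_eLpNorm_cutoffConvolutionCLM_sq_ne_top (hg : MemWeightedL2 δ g)
    (χ : 𝓓_{K}(RSpace n, ℂ)) {ι : Type*} [Countable ι] {v : ι → 𝓓((⊤ : Opens (RSpace n)), ℂ)}
    (hv : Orthonormal ℂ fun i => weightedToL2CLM n (-δ) (testFunctionToSchwartzCLM ⊤ (v i))) :
    ∑' i, eLpNorm (cutoffConvolutionCLM hg.locallyIntegrable χ (v i)) 2 volume ^ 2 ≠ ⊤ := by
  obtain ⟨C, hC, hle⟩ := exists_eLpNorm_weight_mul_comp_sub_left_le hg K.isCompact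
  have hχ : eLpNorm χ 2 volume ^ 2 ≠ ⊤ := ENNReal.pow_ne_top
    (χ.contDiff.continuous.memLp_of_hasCompactSupport χ.compact_supp).2.ne
  refine ne_top_of_le_ne_top (ENNReal.mul_ne_top hχ (ENNReal.pow_ne_top hC (n := 2))) ?_
  simp only [eLpNorm_two_sq]
  rw [← lintegral_tsum fun i => (SchwartzMap.continuous _).aestronglyMeasurable.enorm.pow_const 2,
    ← lintegral_mul_const' _ _ (ENNReal.pow_ne_top hC)]
  refine lintegral_mono fun y => ?_
  simp only [cutoffConvolutionCLM_apply, enorm_mul, mul_pow]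
  rw [ENNReal.tsum_mul_left]
  by_cases hy : y ∈ K
  · gcongr
    exact (tsum_enorm_integral_mul_sq_le (hg.comp_sub_left y) hv).trans (by gcongr; exact hle y hy)
  · simp [χ.zero_on_compl hy]

theorem HasL2BoundedSecondMoments.ae_exists_memWeightedL2 {Ω : Type*} [MeasurableSpace Ω]
    {P : Measure Ω} {f : Ω → 𝓢'(RSpace n, ℂ)} (hf : HasL2BoundedSecondMoments P f)
    (hg : MemWeightedL2 δ g) (χ : 𝓓_{K}(RSpace n, ℂ)) :
    ∀ᵐ w ∂P, ∃ u, MemWeightedL2 δ u ∧ ∀ φ : 𝓓((⊤ : Opens (RSpace n)), ℂ),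
      f w (cutoffConvolutionCLM hg.locallyIntegrable χ φ) = ∫ x, u x * φ x := by
  obtain ⟨C, hC⟩ := hf.eLpNorm_le K K.isCompact
  let T := cutoffConvolutionCLM hg.locallyIntegrable χ
  let J := weightedToL2CLM n (-δ) ∘L testFunctionToSchwartzCLM (⊤ : Opens (RSpace n)) (F := ℂ)
  let ℓ (w : Ω) : 𝓓((⊤ : Opens (RSpace n)), ℂ) →L[ℂ] ℂ :=
    (f w : 𝓢(RSpace n, ℂ) →L[ℂ] ℂ) ∘L T
  have hJ : Function.Injective J := (injective_weightedToL2CLM n (-δ)).comp fun φ ψ h => by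
    ext x
    exact DFunLike.congr_fun h x
  have hℓ (φ : 𝓓((⊤ : Opens (RSpace n)), ℂ)) :
      ∫⁻ w, ‖ℓ w φ‖ₑ ^ 2 ∂P ≤ C ^ 2 * eLpNorm (T φ) 2 volume ^ 2 := by
    rw [← eLpNorm_two_sq, ← mul_pow]
    gcongr
    refine hC _ fun x hx => ?_
    exact (cutoffConvolutionCLM_apply _ χ φ x).trans (by simp [χ.zero_on_compl hx])
  have hrep : ∀ᵐ w ∂P, ∃ h, ∀ φ, ℓ w φ = inner ℂ h (J φ) := by
    refine ae_exists_forall_eq_inner hJ (fun φ => hf.aestronglyMeasurable _) fun s hs hortho => ?_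
    have : Countable s := hs
    refine ne_top_of_le_ne_top ?_ (ENNReal.tsum_le_tsum fun v : s => hℓ v)
    rw [ENNReal.tsum_mul_left]
    exact ENNReal.mul_ne_top (ENNReal.pow_ne_top ENNReal.coe_ne_top)
      (tsum_eLpNorm_cutoffConvolutionCLM_sq_ne_top hg χ hortho)
  filter_upwards [hrep] with w ⟨h, hh⟩
  obtain ⟨u, hu, huh⟩ := exists_memWeightedL2_integral_mul_eq_inner δ h
  exact ⟨u, hu, fun φ => (hh φ).trans (huh _).symm⟩

end RandomConvolution

/-! ### Supports of distributions -/

section Support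

variable {n : ℕ} {f : 𝓢'(RSpace n, ℂ)} {ψ ψ' : 𝓢(RSpace n, ℂ)}

theorem exists_eq_sum_tsupport_subset {ι : Type*} [Fintype ι] (hψ : HasCompactSupport ψ)
    {U : ι → Set (RSpace n)} (hU : ∀ i, IsOpen (U i)) (hψU : tsupport ψ ⊆ ⋃ i, U i) :
    ∃ Ψ : ι → 𝓢(RSpace n, ℂ), (∀ i, tsupport (Ψ i) ⊆ U i) ∧ ψ = ∑ i, Ψ i := by
  obtain ⟨ρ, hρ⟩ := SmoothPartitionOfUnity.exists_isSubordinate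
    (modelWithCornersSelf ℝ (RSpace n)) (isClosed_tsupport ψ) U hU hψU
  have hsmooth (i : ι) : ContDiff ℝ ∞ fun x => (ρ i x : ℂ) * ψ x :=
    (Complex.ofRealCLM.contDiff.comp (ρ i).contMDiff.contDiff).mul (ψ.smooth ⊤)
  refine ⟨fun i => (hψ.mul_left : HasCompactSupport fun x => (ρ i x : ℂ) * ψ x).toSchwartzMap
    (hsmooth i), fun i => (closure_mono fun x hx => ?_).trans (hρ i), ?_⟩
  · exact Complex.ofReal_ne_zero.1 (left_ne_zero_of_mul hx)
  · ext x
    rw [sum_apply]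
    change ψ x = ∑ i, (ρ i x : ℂ) * ψ x
    rw [← Finset.sum_mul, ← Complex.ofReal_sum, ← finsum_eq_sum_of_fintype]
    by_cases hx : x ∈ tsupport ψ
    · rw [ρ.sum_eq_one hx, Complex.ofReal_one, one_mul]
    · rw [image_eq_zero_of_notMem_tsupport hx, mul_zero]

theorem apply_eq_zero_of_tsupport_subset_compl_dsupport (hψ : HasCompactSupport ψ)
    (hd : tsupport ψ ⊆ (Distribution.dsupport f)ᶜ) : f ψ = 0 := by
  rw [Distribution.dsupport_compl_eq, Set.sUnion_eq_iUnion] at hd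
  obtain ⟨t, ht⟩ := hψ.isCompact.elim_finite_subcover _ (fun U => U.2.2) hd
  rw [← Finset.set_biUnion_coe, Set.biUnion_eq_iUnion] at ht
  obtain ⟨Ψ, hΨ, rfl⟩ := exists_eq_sum_tsupport_subset hψ (fun U : t => U.1.2.2) ht
  rw [map_sum]
  exact Finset.sum_eq_zero fun U _ => U.1.2.1 _ (hΨ U)

theorem apply_eq_of_eventuallyEq_dsupport (hψ : HasCompactSupport ψ) (hψ' : HasCompactSupport ψ')
    (h : ψ =ᶠ[𝓝ˢ (Distribution.dsupport f)] ψ') : f ψ = f ψ' := by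
  rw [← sub_eq_zero, ← map_sub]
  refine apply_eq_zero_of_tsupport_subset_compl_dsupport (hψ.sub hψ') fun x hx hxf => ?_
  refine notMem_tsupport_iff_eventuallyEq.2 ?_ hx
  filter_upwards [h.filter_mono (nhds_le_nhdsSet hxf)] with y hy
  exact sub_eq_zero.2 hy

end Support

/-! ### The resolvent -/

section Resolvent

variable {k δ : ℝ}

theorem resolvent_eq_convolution (k : ℝ) (φ : RSpace 3 → ℂ) :
    resolvent k φ = φ ⋆[.mul ℝ ℂ] fun x => outgoingKernel k x 0 := by
  ext x
  simp only [resolvent, convolution_def, ContinuousLinearMap.mul_apply', outgoingKernel, sub_zero,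
    mul_comm]

theorem integrable_inv_norm_sq_mul_rpow (hδ : δ < -1 / 2) :
    Integrable (fun x : RSpace 3 => ‖x‖⁻¹ ^ 2 * (1 + ‖x‖ ^ 2) ^ δ) volume := by
  rw [integrable_fun_norm_addHaar (μ := volume) (f := fun t : ℝ => t⁻¹ ^ 2 * (1 + t ^ 2) ^ δ)]
  have h := (integrable_rpow_neg_one_add_norm_sq (E := ℝ) (μ := volume) (r := -(2 * δ))
    (by simp; linarith)).integrableOn (s := Set.Ioi 0)
  refine h.congr_fun (fun t ht => ?_) measurableSet_Ioi
  have ht0 : t ≠ 0 := (Set.mem_Ioi.1 ht).ne'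
  have hexp : - -(2 * δ) / 2 = δ := by ring
  simp only [finrank_euclideanSpace, Fintype.card_fin, smul_eq_mul, Real.norm_eq_abs, sq_abs, hexp]
  field_simp

theorem norm_outgoingKernel (k : ℝ) (x y : RSpace 3) :
    ‖outgoingKernel k x y‖ = (4 * Real.pi)⁻¹ * ‖x - y‖⁻¹ := by
  have h : ‖Complex.exp (Complex.I * k * ‖x - y‖)‖ = 1 := by
    rw [Complex.norm_exp]
    simp
  rw [outgoingKernel, norm_div, h, one_div, norm_mul, norm_mul]
  simp [Real.pi_pos.le, mul_comm]

theorem memWeightedL2_outgoingKernel (k : ℝ) (hδ : δ < -1 / 2) :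
    MemWeightedL2 δ fun x => outgoingKernel k x 0 := by
  have hloc := locallyIntegrable_outgoingKernel k
  refine ⟨hloc, (memLp_two_iff_integrable_sq_norm ?_).2 ?_⟩
  · exact (Complex.continuous_ofReal.comp (continuous_weight δ)).aestronglyMeasurable.mul
      hloc.aestronglyMeasurable
  · convert (integrable_inv_norm_sq_mul_rpow hδ).const_mul ((4 * Real.pi)⁻¹ ^ 2) using 2 with x
    have hsq : ((1 + ‖x‖ ^ 2) ^ (δ / 2)) ^ 2 = (1 + ‖x‖ ^ 2) ^ δ := by
      rw [← Real.rpow_mul_natCast (by positivity), Nat.cast_ofNat, div_mul_cancel₀ _ two_ne_zero]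
    rw [norm_mul, norm_outgoingKernel, Complex.norm_real, Real.norm_of_nonneg (by positivity),
      mul_pow, hsq, sub_zero]
    ring

/-- A smooth compactly supported function as an element of Mathlib's space `𝓓` of test functions. -/
def TestFn.toTestFunction (φ : TestFn) : 𝓓((⊤ : Opens (RSpace 3)), ℂ) :=
  ⟨φ.toFun, φ.smooth, φ.compactSupport, fun _ _ => trivial⟩

/-- A smooth compactly supported function as an element of the space of smooth functions supported
in the compact set `tsupport φ`. -/
def TestFn.toSupportedIn (φ : TestFn) :
    𝓓_{(⟨tsupport φ.toFun, φ.compactSupport.isCompact⟩ : Compacts (RSpace 3))}(RSpace 3, ℂ) :=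
  .of_support_subset φ.smooth (subset_tsupport φ.toFun)

theorem cutoffResolvent_eq_cutoffConvolutionCLM (k : ℝ) (χ φ : TestFn) :
    cutoffResolvent k χ φ = cutoffConvolutionCLM (locallyIntegrable_outgoingKernel k)
      χ.toSupportedIn φ.toTestFunction := by
  ext x
  change χ.toFun x * resolvent k φ.toFun x = _
  rw [resolvent_eq_convolution]
  rfl

theorem exists_testFn_eq_one {D : Set (RSpace 3)} (hD : Bornology.IsBounded D) :
    ∃ χ : TestFn, ∀ s ⊆ D, ∀ᶠ x in 𝓝ˢ s, χ.toFun x = 1 := by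
  obtain ⟨r, hr, hDr⟩ := hD.subset_ball_lt 0 0
  let b : ContDiffBump (0 : RSpace 3) := ⟨r, r + 1, hr, lt_add_one r⟩
  refine ⟨⟨fun x => b x, Complex.ofRealCLM.contDiff.comp b.contDiff,
    b.hasCompactSupport.comp_left Complex.ofReal_zero⟩, fun s hs => ?_⟩
  filter_upwards [Metric.isOpen_ball.mem_nhdsSet.2 (hs.trans hDr)] with x hx
  simp [b.one_of_mem_closedBall (Metric.ball_subset_closedBall hx)]

theorem isResolventOf_of_forall_integral_eq {D : Set (RSpace 3)} (hD : Bornology.IsBounded D)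
    {f : 𝓢'(RSpace 3, ℂ)} (hf : Distribution.dsupport f ⊆ D) {χ : TestFn}
    (hχ : ∀ᶠ x in 𝓝ˢ (Distribution.dsupport f), χ.toFun x = 1) {u : RSpace 3 → ℂ}
    (hu : LocallyIntegrable u volume)
    (hfu : ∀ φ : TestFn, f (cutoffResolvent k χ φ) = ∫ x, u x * φ.toFun x) :
    IsResolventOf k f u := by
  refine ⟨Metric.isCompact_of_isClosed_isBounded Distribution.isClosed_dsupport (hD.subset hf),
    hu, fun χ' φ hχ' => ?_⟩
  rw [← hfu φ]
  refine apply_eq_of_eventuallyEq_dsupport χ'.compactSupport.mul_right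
    χ.compactSupport.mul_right ?_
  filter_upwards [hχ, hχ'] with x hx hx'
  change χ'.toFun x * resolvent k φ.toFun x = χ.toFun x * resolvent k φ.toFun x
  rw [hx, hx']

theorem HasL2BoundedSecondMoments.ae_resolventMemWeightedL2 {Ω : Type*} [MeasurableSpace Ω]
    {P : Measure Ω} {f : Ω → 𝓢'(RSpace 3, ℂ)} (hf : HasL2BoundedSecondMoments P f)
    {D : Set (RSpace 3)} (hD : Bornology.IsBounded D)
    (hfD : ∀ᵐ w ∂P, Distribution.dsupport (f w) ⊆ D) (k : ℝ) (hδ : δ < -1 / 2) :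
    ∀ᵐ w ∂P, ResolventMemWeightedL2 k (f w) δ := by
  obtain ⟨χ, hχ⟩ := exists_testFn_eq_one hD
  have hΦ := memWeightedL2_outgoingKernel k hδ
  filter_upwards [hf.ae_exists_memWeightedL2 hΦ χ.toSupportedIn, hfD] with w ⟨u, hu, hfu⟩ hw
  refine ⟨u, isResolventOf_of_forall_integral_eq hD hw (hχ _ hw) hu.locallyIntegrable
    fun φ => ?_, hu⟩
  rw [cutoffResolvent_eq_cutoffConvolutionCLM]
  exact hfu φ.toTestFunction

theorem ResolventMemWeightedL2.mono {δ' : ℝ} {f : 𝓢'(RSpace 3, ℂ)} (h : δ ≤ δ')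
    (hf : ResolventMemWeightedL2 k f δ') : ResolventMemWeightedL2 k f δ :=
  let ⟨u, hu, hmem⟩ := hf
  ⟨u, hu, hmem.mono h⟩

end Resolvent

end

end RandomScattering

theorem lemma2p2_general {Ω : Type*} [MeasurableSpace Ω] {P : Measure Ω}
    {f : Ω → 𝓢'(RandomScattering.RSpace 3, ℂ)}
    (hf : RandomScattering.HasL2BoundedSecondMoments P f)
    {D : Set (RandomScattering.RSpace 3)} (hD : Bornology.IsBounded D)
    (hfD : ∀ᵐ ω ∂P, Distribution.dsupport (f ω) ⊆ D) (k : ℝ) :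
    ∀ᵐ ω ∂P, ∀ ε : ℝ, 0 < ε →
      RandomScattering.ResolventMemWeightedL2 k (f ω) (-1 / 2 - ε) := by
  have h (j : ℕ) :
      ∀ᵐ ω ∂P, RandomScattering.ResolventMemWeightedL2 k (f ω) (-1 / 2 - 1 / (j + 1)) :=
    hf.ae_resolventMemWeightedL2 hD hfD k (sub_lt_self _ Nat.one_div_pos_of_nat)
  filter_upwards [ae_all_iff.2 h] with ω hω ε hε
  obtain ⟨j, hj⟩ := exists_nat_one_div_lt hε
  exact (hω j).mono (by linarith)

theorem lemma2p2 {Ω : Type*} [MeasurableSpace Ω] (P : Measure Ω) [IsProbabilityMeasure P]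
    (f : Ω → 𝓢'(RandomScattering.RSpace 3, ℂ)) (m : ℝ) (hm : 2 < m)
    (μ : RandomScattering.RSpace 3 → ℝ)
    (D : Set (RandomScattering.RSpace 3)) (hD : Bornology.IsBounded D)
    (hf : RandomScattering.IsMigrField P f m μ D)
    (k : ℝ) (hk : 0 < k) :
    ∀ᵐ ω ∂P, ∀ ε : ℝ, 0 < ε →
      RandomScattering.ResolventMemWeightedL2 k (f ω) (-1 / 2 - ε) :=
  lemma2p2_general (hf.hasL2BoundedSecondMoments (by norm_num; linarith)) hD hf.support_subset k
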